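/- Let $\mathsf{k}$ be a field and let $B$ be a (unital, associative, $\mathbb{Z}$-graded, cohomological) DG-algebra over $\mathsf{k}$. A Maurer–Cartan element of $B$ is an element $c\in B^1$ with $dc+c^2=0$. For Maurer–Cartan elements $a,c$ let ${}_aB_c$ be the graded vector space $B$ with the differential $d_{(a,c)}(x)=dx+ax-(-1)^{|x|}xc$; in particular ${}_cB_c$ is a DG-algebra with the multiplication of $B$. The Maurer–Cartan DG-category $\mathsf{MC}(B)$ has the Maurer–Cartan elements of $B$ as objects and Hom-complexes $\operatorname{Hom}_{\mathsf{MC}(B)}(a,c)={}_aB_c$, with composition $\operatorname{Hom}(a,c)\otimes\operatorname{Hom}(c,e)\to\operatorname{Hom}(a,e)$ given by the multiplication of $B$. A DG-module $M$ over a small DG-category $\mathsf{A}$ over $\mathsf{k}$ consists of complexes $M(a)$ of $\mathsf{k}$-vector spaces and of morphisms of complexes $\mathsf{A}(a,c)\otimes M(c)\to M(a)$ compatible with units and composition (for a DG-category with one object: a left DG-module over a DG-algebra). The homotopy category $\mathsf{Ho}(\mathsf{A})$ has the DG-modules as objects and homotopy classes of closed morphisms of degree $0$ as morphisms. Let $\mathsf{CoAcycl}\subset\mathsf{Ho}(\mathsf{A})$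 be the smallest full triangulated subcategory that contains the totalizations of exact triples of DG-modules and is closed under infinite direct sums; the coderived category $\mathsf{D}^{co}(\mathsf{A})$ is the Verdier quotient $\mathsf{Ho}(\mathsf{A})/\mathsf{CoAcycl}$. Then for every Maurer–Cartan element $b\in B$ there is an equivalence of categories $$\mathsf{D}^{co}(\mathsf{MC}(B))\simeq\mathsf{D}^{co}({}_bB_b).$$ It is induced by the restriction functor $F\colon \mathsf{DGMod}(\mathsf{MC}(B))\to\mathsf{DGMod}({}_bB_b)$, $F(M)=M(b)$, and its quasi-inverse is induced by the functor $G\colon\mathsf{DGMod}({}_bB_b)\to\mathsf{DGMod}(\mathsf{MC}(B))$, $G(N)(a)={}_aB_b\otimes_{{}_bB_b}N$, where morphisms $f\in{}_{a_1}B_{a_2}$ of $\mathsf{MC}(B)$ act by multiplication by $f$ on the left. -/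

import Mathlib

open CategoryTheory
open scoped TensorProduct DirectSum

universe w v u

set_option linter.checkUnivs false

/-- The sign `(-1)^n`, for an integer `n`. -/
def koszulSign (n : ℤ) : ℤ := ((n.negOnePow : ℤˣ) : ℤ)

theorem koszulSign_zero : koszulSign 0 = 1 := by simp [koszulSign]

theorem koszulSign_add (m n : ℤ) : koszulSign (m + n) = koszulSign m * koszulSign n := by
  simp [koszulSign, Int.negOnePow_add]

theorem koszulSign_succ (n : ℤ) : koszulSign (n + 1) = -koszulSign n := by
  simp [koszulSign, Int.negOnePow_succ]

theorem koszulSign_mul_self (n : ℤ) : koszulSign n * koszulSign n = 1 := by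
  rw [koszulSign, ← Units.val_mul, Int.units_mul_self, Units.val_one]

/-! ### DG-algebras and DG-categories -/

/-- A (unital, associative, `ℤ`-graded, cohomological) DG-algebra over the field `k`: a graded
algebra with a differential of degree `1`, given degree by degree, satisfying the Leibniz rule. -/
structure DGAlgebra (k : Type w) [Field k] where
  carrier : Type u
  [ring : Ring carrier]
  [algebra : Algebra k carrier]
  gr : ℤ → Submodule k carrier
  [graded : GradedAlgebra gr]
  d : ∀ i : ℤ, gr i →ₗ[k] gr (i + 1)
  d_d : ∀ (i : ℤ) (x : gr i), d (i + 1) (d i x) = 0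
  leibniz : ∀ (i j : ℤ) (x : gr i) (y : gr j),
    (d (i + j) ⟨(x : carrier) * y, SetLike.mul_mem_graded x.2 y.2⟩ : carrier) =
      (d i x : carrier) * y + koszulSign i • ((x : carrier) * d j y)

attribute [instance] DGAlgebra.ring DGAlgebra.algebra DGAlgebra.graded

/-- A DG-category over the field `k`: a category enriched in complexes of `k`-vector spaces.
Composition is written in the order `Hom a b ⊗ Hom b c → Hom a c`; thus `Hom a b` acts from objects
indexed by `b` to objects indexed by `a`. The equations `i + j = n` only serve to keep track of
degrees. -/
structure DGCategory (k : Type w) [Field k] where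
  Obj : Type v
  Hom : Obj → Obj → ℤ → Type u
  [addCommGroup : ∀ a b i, AddCommGroup (Hom a b i)]
  [module : ∀ a b i, Module k (Hom a b i)]
  d : ∀ (a b : Obj) (i : ℤ), Hom a b i →ₗ[k] Hom a b (i + 1)
  d_d : ∀ (a b : Obj) (i : ℤ) (f : Hom a b i), d a b (i + 1) (d a b i f) = 0
  one : ∀ a : Obj, Hom a a 0
  comp : ∀ (a b c : Obj) (i j n : ℤ), i + j = n → Hom a b i →ₗ[k] Hom b c j →ₗ[k] Hom a c n
  one_comp : ∀ (a b : Obj) (i : ℤ) (f : Hom a b i), comp a a b 0 i i (zero_add i) (one a) f = f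
  comp_one : ∀ (a b : Obj) (i : ℤ) (f : Hom a b i), comp a b b i 0 i (add_zero i) f (one b) = f
  assoc : ∀ (a b c e : Obj) (i j l ij jl n : ℤ) (hij : i + j = ij) (hjl : j + l = jl)
    (h₁ : ij + l = n) (h₂ : i + jl = n) (f : Hom a b i) (g : Hom b c j) (h : Hom c e l),
    comp a c e ij l n h₁ (comp a b c i j ij hij f g) h =
      comp a b e i jl n h₂ f (comp b c e j l jl hjl g h)
  leibniz : ∀ (a b c : Obj) (i j n : ℤ) (h : i + j = n) (f : Hom a b i) (g : Hom b c j),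
    d a c n (comp a b c i j n h f g) =
      comp a b c (i + 1) j (n + 1) (by omega) (d a b i f) g +
        koszulSign i • comp a b c i (j + 1) (n + 1) (by omega) f (d b c j g)

attribute [instance] DGCategory.addCommGroup DGCategory.module

namespace DGAlgebra

variable {k : Type w} [Field k]

/-- Maurer–Cartan elements: elements `c` of degree `1` with `d c + c ^ 2 = 0`. -/
def MaurerCartan (B : DGAlgebra.{w, u} k) : Type u :=
  {c : B.gr 1 // (B.d 1 c : B.carrier) + (c : B.carrier) * c = 0}

/-- The underlying element of the algebra of a Maurer–Cartan element. -/
def MaurerCartan.val {B : DGAlgebra.{w, u} k} (c : B.MaurerCartan) : B.carrier :=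
  ((c : {c : B.gr 1 // (B.d 1 c : B.carrier) + (c : B.carrier) * c = 0}).1 : B.carrier)

/-- The multiplication of a DG-algebra in given degrees. -/
def mul (B : DGAlgebra.{w, u} k) (i j n : ℤ) (h : i + j = n) :
    B.gr i →ₗ[k] B.gr j →ₗ[k] B.gr n :=
  LinearMap.mk₂ k
    (fun x y => ⟨(x : B.carrier) * y, h ▸ SetLike.mul_mem_graded x.2 y.2⟩)
    (fun _ _ _ => Subtype.ext (add_mul _ _ _))
    (fun _ _ _ => Subtype.ext (smul_mul_assoc _ _ _))
    (fun _ _ _ => Subtype.ext (mul_add _ _ _))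
    (fun _ _ _ => Subtype.ext (mul_smul_comm _ _ _))

@[simp]
theorem coe_mul (B : DGAlgebra.{w, u} k) (i j n : ℤ) (h : i + j = n) (x : B.gr i) (y : B.gr j) :
    (B.mul i j n h x y : B.carrier) = x * y := rfl

theorem d_mul (B : DGAlgebra.{w, u} k) (i j n : ℤ) (h : i + j = n) (x : B.gr i) (y : B.gr j) :
    (B.d n (B.mul i j n h x y) : B.carrier) =
      (B.d i x : B.carrier) * y + koszulSign i • ((x : B.carrier) * B.d j y) := by
  subst h
  exact B.leibniz i j x y

/-- The twisted differential `x ↦ d x + a x - (-1)^|x| x b` of the complex `ₐB_b`. -/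
def twistedD (B : DGAlgebra.{w, u} k) (a b : B.MaurerCartan) (i : ℤ) :
    B.gr i →ₗ[k] B.gr (i + 1) :=
  B.d i + B.mul 1 i (i + 1) (add_comm 1 i) a.1 -
    koszulSign i • (B.mul i 1 (i + 1) rfl).flip b.1

theorem coe_twistedD (B : DGAlgebra.{w, u} k) (a b : B.MaurerCartan) (i : ℤ) (x : B.gr i) :
    (B.twistedD a b i x : B.carrier) =
      (B.d i x : B.carrier) + a.val * x - koszulSign i • ((x : B.carrier) * b.val) := by
  simp [twistedD, MaurerCartan.val]

theorem twistedD_twistedD (B : DGAlgebra.{w, u} k) (a b : B.MaurerCartan) (i : ℤ) (x : B.gr i) :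
    B.twistedD a b (i + 1) (B.twistedD a b i x) = 0 := by
  have ha : (B.d 1 a.1 : B.carrier) = -(a.val * a.val) := eq_neg_of_add_eq_zero_left a.2
  have hb : (B.d 1 b.1 : B.carrier) = -(b.val * b.val) := eq_neg_of_add_eq_zero_left b.2
  have h1 : (B.d (i + 1) (B.twistedD a b i x) : B.carrier) =
      -(a.val * a.val * x) - a.val * B.d i x
        - koszulSign i • ((B.d i x : B.carrier) * b.val) + x * (b.val * b.val) := by
    have h1 : koszulSign 1 = -1 := by simp [koszulSign]
    have h2 : B.twistedD a b i x = B.d i x + B.mul 1 i (i + 1) (add_comm 1 i) a.1 x -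
      koszulSign i • B.mul i 1 (i + 1) rfl x b.1 := rfl
    rw [h2, map_sub, map_add, map_zsmul, B.d_d, zero_add, AddSubgroupClass.coe_sub,
      AddSubgroupClass.coe_zsmul, d_mul, d_mul, ha, hb, h1]
    simp only [smul_add, smul_smul, koszulSign_mul_self, MaurerCartan.val, neg_mul, mul_neg,
      one_smul, neg_smul]
    abel
  apply Subtype.ext
  rw [coe_twistedD, h1, coe_twistedD, koszulSign_succ]
  simp only [mul_add, mul_sub, add_mul, sub_mul, smul_add, smul_sub, neg_smul, mul_smul_comm,
    smul_mul_assoc, smul_smul, mul_assoc, Submodule.coe_zero]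
  simp only [neg_mul, koszulSign_mul_self, neg_smul, one_smul]
  abel_nf

theorem twistedD_mul (B : DGAlgebra.{w, u} k) (a b c : B.MaurerCartan) (i j n : ℤ)
    (h : i + j = n) (x : B.gr i) (y : B.gr j) :
    (B.twistedD a c n (B.mul i j n h x y) : B.carrier) =
      (B.twistedD a b i x : B.carrier) * y + koszulSign i • ((x : B.carrier) * B.twistedD b c j y) := by
  simp only [coe_twistedD, d_mul, coe_mul]
  subst h
  simp only [koszulSign_add, mul_add, mul_sub, add_mul, sub_mul, smul_add, smul_sub,
    mul_smul_comm, smul_mul_assoc, smul_smul, mul_assoc]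
  abel

/-- The twisted DG-algebra `_bB_b`: the same graded algebra, with the differential
`x ↦ d x + [b, x] = d x + b x - (-1)^|x| x b`. -/
def twist (B : DGAlgebra.{w, u} k) (b : B.MaurerCartan) : DGAlgebra.{w, u} k where
  carrier := B.carrier
  gr := B.gr
  d := B.twistedD b b
  d_d := B.twistedD_twistedD b b
  leibniz i j x y := B.twistedD_mul b b b i j _ rfl x y

/-- A DG-algebra viewed as a DG-category with one object. -/
def toDGCategory (R : DGAlgebra.{w, u} k) : DGCategory.{w, u, u} k where
  Obj := PUnit
  Hom _ _ i := R.gr i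
  d _ _ i := R.d i
  d_d _ _ := R.d_d
  one _ := ⟨1, SetLike.one_mem_graded R.gr⟩
  comp _ _ _ := R.mul
  one_comp _ _ _ _ := Subtype.ext (one_mul _)
  comp_one _ _ _ _ := Subtype.ext (mul_one _)
  assoc _ _ _ _ _ _ _ _ _ _ _ _ _ _ _ _ _ := Subtype.ext (mul_assoc _ _ _)
  leibniz _ _ _ i j n h f g := Subtype.ext (by simpa using R.d_mul i j n h f g)

/-- The unique object of a DG-algebra viewed as a DG-category. -/
def pt (R : DGAlgebra.{w, u} k) : R.toDGCategory.Obj := PUnit.unit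

/-- The Maurer–Cartan DG-category `MC(B)`: its objects are the Maurer–Cartan elements of `B`,
`Hom a b` is the complex `ₐB_b`, and the composition is the multiplication of `B`. -/
def MC (B : DGAlgebra.{w, u} k) : DGCategory.{w, u, u} k where
  Obj := B.MaurerCartan
  Hom _ _ i := B.gr i
  d := B.twistedD
  d_d := B.twistedD_twistedD
  one _ := ⟨1, SetLike.one_mem_graded B.gr⟩
  comp _ _ _ := B.mul
  one_comp _ _ _ _ := Subtype.ext (one_mul _)
  comp_one _ _ _ _ := Subtype.ext (mul_one _)
  assoc _ _ _ _ _ _ _ _ _ _ _ _ _ _ _ _ _ := Subtype.ext (mul_assoc _ _ _)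
  leibniz a b c i j n h f g := Subtype.ext (by simpa using B.twistedD_mul a b c i j n h f g)

/-- A Maurer–Cartan element viewed as an object of `MC(B)`. -/
def MaurerCartan.toObj {B : DGAlgebra.{w, u} k} (b : B.MaurerCartan) : B.MC.Obj := b

end DGAlgebra

/-! ### DG-modules -/

/-- A DG-module over a DG-category `A`, that is a DG-functor from `A` to complexes of
`k`-vector spaces: complexes `X a` and action maps `Hom a b ⊗ X b → X a`, which are morphisms of
complexes and are compatible with units and composition. For a DG-category with one object this is
a left DG-module over a DG-algebra. -/
structure DGModule {k : Type w} [Field k] (A : DGCategory.{w, v, u} k) where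
  X : A.Obj → ℤ → Type u
  [addCommGroup : ∀ a i, AddCommGroup (X a i)]
  [module : ∀ a i, Module k (X a i)]
  d : ∀ (a : A.Obj) (i : ℤ), X a i →ₗ[k] X a (i + 1)
  d_d : ∀ (a : A.Obj) (i : ℤ) (x : X a i), d a (i + 1) (d a i x) = 0
  act : ∀ (a b : A.Obj) (i j n : ℤ), i + j = n → A.Hom a b i →ₗ[k] X b j →ₗ[k] X a n
  one_act : ∀ (a : A.Obj) (i : ℤ) (x : X a i), act a a 0 i i (zero_add i) (A.one a) x = x
  comp_act : ∀ (a b c : A.Obj) (i j l ij jl n : ℤ) (hij : i + j = ij) (hjl : j + l = jl)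
    (h₁ : ij + l = n) (h₂ : i + jl = n) (f : A.Hom a b i) (g : A.Hom b c j) (x : X c l),
    act a c ij l n h₁ (A.comp a b c i j ij hij f g) x =
      act a b i jl n h₂ f (act b c j l jl hjl g x)
  leibniz : ∀ (a b : A.Obj) (i j n : ℤ) (h : i + j = n) (f : A.Hom a b i) (x : X b j),
    d a n (act a b i j n h f x) =
      act a b (i + 1) j (n + 1) (by omega) (A.d a b i f) x +
        koszulSign i • act a b i (j + 1) (n + 1) (by omega) f (d b j x)

attribute [instance] DGModule.addCommGroup DGModule.module

namespace DGModule

variable {k : Type w} [Field k] {A : DGCategory.{w, v, u} k}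

/-- Closed morphisms of degree `0` between DG-modules. -/
@[ext]
structure Hom (M N : DGModule A) where
  app : ∀ (a : A.Obj) (i : ℤ), M.X a i →ₗ[k] N.X a i
  app_d : ∀ (a : A.Obj) (i : ℤ) (x : M.X a i), app a (i + 1) (M.d a i x) = N.d a i (app a i x)
  app_act : ∀ (a b : A.Obj) (i j n : ℤ) (h : i + j = n) (f : A.Hom a b i) (x : M.X b j),
    app a n (M.act a b i j n h f x) = N.act a b i j n h f (app b j x)

/-- The category of DG-modules over `A` and closed morphisms of degree `0`. -/
instance : Category (DGModule A) where
  Hom := Hom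
  id M :=
    { app := fun _ _ => LinearMap.id
      app_d := fun _ _ _ => rfl
      app_act := fun _ _ _ _ _ _ _ _ => rfl }
  comp φ ψ :=
    { app := fun a i => (ψ.app a i).comp (φ.app a i)
      app_d := fun a i x => by simp [φ.app_d, ψ.app_d]
      app_act := fun a b i j n h f x => by simp [φ.app_act, ψ.app_act] }

@[simp]
theorem id_app (M : DGModule A) (a : A.Obj) (i : ℤ) : Hom.app (𝟙 M) a i = LinearMap.id := rfl

@[simp]
theorem comp_app {L M N : DGModule A} (φ : L ⟶ M) (ψ : M ⟶ N) (a : A.Obj) (i : ℤ) :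
    Hom.app (φ ≫ ψ) a i = (ψ.app a i).comp (φ.app a i) := rfl

/-- A homotopy from `φ` to `ψ`: an `A`-linear map `s` of degree `-1` with `φ - ψ = d s + s d`
(`s a i` maps degree `i + 1` to degree `i`). -/
structure Homotopy {M N : DGModule A} (φ ψ : M ⟶ N) where
  s : ∀ (a : A.Obj) (i : ℤ), M.X a (i + 1) →ₗ[k] N.X a i
  s_act : ∀ (a b : A.Obj) (i j n : ℤ) (h : i + j = n) (f : A.Hom a b i) (x : M.X b (j + 1)),
    s a n (M.act a b i (j + 1) (n + 1) (by omega) f x) =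
      koszulSign i • N.act a b i j n h f (s b j x)
  eq : ∀ (a : A.Obj) (i : ℤ) (x : M.X a (i + 1)),
    φ.app a (i + 1) x - ψ.app a (i + 1) x = N.d a i (s a i x) + s a (i + 1) (M.d a (i + 1) x)

/-- The relation of being homotopic. -/
def homotopic (A : DGCategory.{w, v, u} k) : HomRel (DGModule A) :=
  fun _ _ φ ψ => Nonempty (Homotopy φ ψ)

/-- Being homotopic is an equivalence relation compatible with composition, so the quotient category
below identifies exactly the homotopic morphisms. -/
theorem homotopic_congruence (A : DGCategory.{w, v, u} k) : Congruence (homotopic A) where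
  equivalence :=
    { refl := fun φ => ⟨{ s := fun _ _ => 0, s_act := by simp, eq := by simp }⟩
      symm := by
        rintro φ ψ ⟨h⟩
        exact ⟨{ s := fun a i => -h.s a i
                 s_act := fun a b i j n hn f x => by simp [h.s_act a b i j n hn f x]
                 eq := fun a i x => by
                  rw [← neg_sub, h.eq a i x]
                  simp only [LinearMap.neg_apply, map_neg]
                  abel }⟩
      trans := by
        rintro φ ψ χ ⟨h⟩ ⟨h'⟩
        exact ⟨{ s := fun a i => h.s a i + h'.s a i
                 s_act := fun a b i j n hn f x => by
                  simp [h.s_act a b i j n hn f x, h'.s_act a b i j n hn f x]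
                 eq := fun a i x => by
                  rw [← sub_add_sub_cancel _ (ψ.app a (i + 1) x), h.eq a i x, h'.eq a i x]
                  simp only [LinearMap.add_apply, map_add]
                  abel }⟩ }
  comp_left := by
    rintro L M N θ φ ψ ⟨h⟩
    exact ⟨{ s := fun a i => (h.s a i).comp (θ.app a (i + 1))
             s_act := fun a b i j n hn f x => by
              simp [θ.app_act a b i (j + 1) (n + 1) (by omega), h.s_act a b i j n hn]
             eq := fun a i x => by
              have := h.eq a i (θ.app a (i + 1) x)
              rw [← θ.app_d] at this
              exact this }⟩
  comp_right := by
    rintro L M N φ ψ θ ⟨h⟩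
    exact ⟨{ s := fun a i => (θ.app a i).comp (h.s a i)
             s_act := fun a b i j n hn f x => by
              simp [θ.app_act, h.s_act a b i j n hn]
             eq := fun a i x => by
              have := congrArg (θ.app a (i + 1)) (h.eq a i x)
              rw [map_sub, map_add, θ.app_d] at this
              exact this }⟩

/-- The homotopy category `Ho(A)` of DG-modules over `A`. -/
abbrev Ho (A : DGCategory.{w, v, u} k) := CategoryTheory.Quotient (homotopic A)

/-- The functor from DG-modules to the homotopy category. -/
abbrev toHo (A : DGCategory.{w, v, u} k) : DGModule A ⥤ Ho A :=
  CategoryTheory.Quotient.functor (homotopic A)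

/-- The shift `M[1]`, with `M[1]^i = M^(i+1)`, differential `-d` and the action of `f` multiplied
by `(-1)^|f|`. -/
def shift (M : DGModule A) : DGModule A where
  X a i := M.X a (i + 1)
  d a i := -M.d a (i + 1)
  d_d a i x := by simp [M.d_d]
  act a b i j n h := koszulSign i • M.act a b i (j + 1) (n + 1) (by omega)
  one_act a i x := by
    simp [koszulSign_zero, M.one_act]
  comp_act a b c i j l ij jl n hij hjl h₁ h₂ f g x := by
    subst hij
    simp only [LinearMap.smul_apply, map_zsmul, koszulSign_add, mul_smul]
    rw [M.comp_act a b c i j (l + 1) (i + j) (jl + 1) (n + 1) rfl (by omega) (by omega) (by omega),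
      smul_comm]
  leibniz a b i j n h f x := by
    simp only [LinearMap.smul_apply, LinearMap.neg_apply, map_zsmul, map_neg, koszulSign_succ,
      M.leibniz a b i (j + 1) (n + 1) (by omega)]
    simp only [smul_add, smul_neg, neg_smul]
    abel

/-- The cone of a closed morphism `φ : M ⟶ N` of degree `0`: the graded module `M[1] ⊕ N` with
differential `(x, y) ↦ (-d x, φ x + d y)`. -/
def cone {M N : DGModule A} (φ : M ⟶ N) : DGModule A where
  X a i := M.X a (i + 1) × N.X a i
  d a i := LinearMap.prod (-(M.d a (i + 1)).comp (LinearMap.fst k _ _))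
    ((φ.app a (i + 1)).comp (LinearMap.fst k _ _) + (N.d a i).comp (LinearMap.snd k _ _))
  d_d a i x := by simp [M.d_d, N.d_d, φ.app_d]
  act a b i j n h := LinearMap.mk₂ k
    (fun f x => (koszulSign i • M.act a b i (j + 1) (n + 1) (by omega) f x.1,
      N.act a b i j n h f x.2))
    (fun _ _ _ => by simp) (fun c _ _ => by simp [smul_comm c (koszulSign i)])
    (fun _ _ _ => by simp) (fun c _ _ => by simp [smul_comm c (koszulSign i)])
  one_act a i x := by
    simp [koszulSign_zero, M.one_act, N.one_act]
  comp_act a b c i j l ij jl n hij hjl h₁ h₂ f g x := by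
    subst hij
    apply Prod.ext
    · simp only [LinearMap.mk₂_apply, map_zsmul, koszulSign_add, mul_smul]
      rw [M.comp_act a b c i j (l + 1) (i + j) (jl + 1) (n + 1) rfl (by omega) (by omega)
        (by omega)]
    · simpa using N.comp_act a b c i j l (i + j) jl n rfl hjl h₁ h₂ f g x.2
  leibniz a b i j n h f x := by
    apply Prod.ext
    · change -M.d a (n + 1) (koszulSign i • M.act a b i (j + 1) (n + 1) (by omega) f x.1) =
        koszulSign (i + 1) • M.act a b (i + 1) (j + 1) (n + 1 + 1) (by omega) (A.d a b i f) x.1 +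
          koszulSign i • koszulSign i •
            M.act a b i (j + 1 + 1) (n + 1 + 1) (by omega) f (-M.d b (j + 1) x.1)
      simp only [map_zsmul, map_neg, koszulSign_succ, M.leibniz a b i (j + 1) (n + 1) (by omega)]
      simp only [smul_add, smul_neg, neg_smul]
      abel
    · change φ.app a (n + 1) (koszulSign i • M.act a b i (j + 1) (n + 1) (by omega) f x.1) +
          N.d a n (N.act a b i j n h f x.2) =
        N.act a b (i + 1) j (n + 1) (by omega) (A.d a b i f) x.2 +
          koszulSign i • N.act a b i (j + 1) (n + 1) (by omega) f
            (φ.app b (j + 1) x.1 + N.d b j x.2)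
      simp only [map_zsmul, map_add, N.leibniz a b i j n h,
        φ.app_act a b i (j + 1) (n + 1) (by omega)]
      simp only [smul_add]
      abel

/-- The direct sum of a family of DG-modules, formed objectwise and degreewise. -/
def directSum {S : Type u} (M : S → DGModule A) : DGModule A where
  X a i := ⨁ s, (M s).X a i
  d a i := DirectSum.lmap fun s => (M s).d a i
  d_d a i x := by
    ext s
    simp [DirectSum.lmap_apply, (M s).d_d]
  act a b i j n h := LinearMap.mk₂ k
    (fun f x => DirectSum.lmap (fun s => (M s).act a b i j n h f) x)
    (fun _ _ _ => by ext; simp [DirectSum.lmap_apply])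
    (fun _ _ _ => by ext; simp [DirectSum.lmap_apply, DirectSum.smul_apply])
    (fun _ _ _ => by simp) (fun _ _ _ => by simp)
  one_act a i x := by
    ext s
    simp [DirectSum.lmap_apply, (M s).one_act]
  comp_act a b c i j l ij jl n hij hjl h₁ h₂ f g x := by
    ext s
    simpa [DirectSum.lmap_apply] using
      (M s).comp_act a b c i j l ij jl n hij hjl h₁ h₂ f g (x s)
  leibniz a b i j n h f x := by
    rw [← Int.cast_smul_eq_zsmul k]
    ext s
    simpa [DirectSum.lmap_apply, DirectSum.smul_apply, Int.cast_smul_eq_zsmul] using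
      (M s).leibniz a b i j n h f (x s)

/-- An exact triple `0 → K → L → M → 0` of DG-modules: closed morphisms of degree `0` forming a
short exact sequence at every object and in every degree. -/
structure ExactTriple (A : DGCategory.{w, v, u} k) where
  K : DGModule A
  L : DGModule A
  M : DGModule A
  ι : K ⟶ L
  π : L ⟶ M
  injective : ∀ a i, Function.Injective (ι.app a i)
  exact : ∀ a i, Function.Exact (ι.app a i) (π.app a i)
  surjective : ∀ a i, Function.Surjective (π.app a i)

namespace ExactTriple

/-- The morphism `Cone(K → L) ⟶ M` induced by `L → M`. -/
def coneDesc (T : ExactTriple A) : cone T.ι ⟶ T.M where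
  app a i := (T.π.app a i).comp (LinearMap.snd k _ _)
  app_d a i x := by
    change T.π.app a (i + 1) (T.ι.app a (i + 1) x.1 + T.L.d a i x.2) = T.M.d a i (T.π.app a i x.2)
    rw [map_add, (T.exact a (i + 1)).apply_apply_eq_zero, zero_add, T.π.app_d]
  app_act a b i j n h f x := T.π.app_act a b i j n h f x.2

/-- The totalization of an exact triple, viewed as a bicomplex with three columns: in degree `i`
it is `K^(i+2) ⊕ L^(i+1) ⊕ M^i`. -/
def tot (T : ExactTriple A) : DGModule A := cone T.coneDesc

end ExactTriple

/-- Coacyclic DG-modules: the objects of the smallest full triangulated subcategory of `Ho(A)`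
that contains the totalizations of exact triples and is closed under infinite direct sums. -/
inductive IsCoacyclic : DGModule A → Prop
  | tot (T : ExactTriple A) : IsCoacyclic T.tot
  | directSum {S : Type u} (M : S → DGModule A) (hM : ∀ s, IsCoacyclic (M s)) :
      IsCoacyclic (directSum M)
  | cone {M N : DGModule A} (φ : M ⟶ N) (hM : IsCoacyclic M) (hN : IsCoacyclic N) :
      IsCoacyclic (cone φ)
  | shift (M : DGModule A) (hM : IsCoacyclic M) : IsCoacyclic M.shift
  | unshift (M : DGModule A) (hM : IsCoacyclic M.shift) : IsCoacyclic M
  | iso {M N : DGModule A} (e : (toHo A).obj M ≅ (toHo A).obj N) (hM : IsCoacyclic M) :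
      IsCoacyclic N

/-- The morphisms of `Ho(A)` whose cone is coacyclic. -/
def coacyclicW (A : DGCategory.{w, v, u} k) : MorphismProperty (Ho A) :=
  fun X Y φ => ∃ f : X.as ⟶ Y.as, (toHo A).map f = φ ∧ IsCoacyclic (cone f)

/-- The coderived category `D^co(A)`: the Verdier quotient of `Ho(A)` by the full subcategory of
coacyclic DG-modules, i.e. the localization at the morphisms with coacyclic cone. -/
noncomputable abbrev Dco (A : DGCategory.{w, v, u} k) := (coacyclicW A).Localization

/-- The functor from DG-modules to the coderived category. -/
noncomputable abbrev toDco (A : DGCategory.{w, v, u} k) : DGModule A ⥤ Dco A :=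
  toHo A ⋙ (coacyclicW A).Q

end DGModule

/-! ### Restriction to `b` and tensoring with `ₐB_b` -/

namespace DGAlgebra

variable {k : Type w} [Field k]

/-- DG-modules over the DG-algebra `_bB_b`. -/
abbrev TwistModule (B : DGAlgebra.{w, u} k) (b : B.MaurerCartan) :=
  DGModule (B.twist b).toDGCategory

/-- The functor `M ↦ M(b)` from DG-modules over `MC(B)` to DG-modules over `_bB_b`. -/
def restrict (B : DGAlgebra.{w, u} k) (b : B.MaurerCartan) : DGModule B.MC ⥤ B.TwistModule b where
  obj M :=
    { X := fun _ i => M.X b.toObj i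
      d := fun _ i => M.d b.toObj i
      d_d := fun _ i x => M.d_d b.toObj i x
      act := fun _ _ i j n h => M.act b.toObj b.toObj i j n h
      one_act := fun _ i x => M.one_act b.toObj i x
      comp_act := fun _ _ _ => M.comp_act b.toObj b.toObj b.toObj
      leibniz := fun _ _ => M.leibniz b.toObj b.toObj }
  map φ :=
    { app := fun _ i => φ.app b.toObj i
      app_d := fun _ i x => φ.app_d b.toObj i x
      app_act := fun _ _ => φ.app_act b.toObj b.toObj }

namespace TwistModule

variable {B : DGAlgebra.{w, u} k} {b : B.MaurerCartan}

/-- The degree `i` part of a DG-module over `_bB_b`. -/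
abbrev deg (N : B.TwistModule b) (i : ℤ) : Type u := N.X (B.twist b).pt i

/-- The action of homogeneous elements of `B` on a DG-module over `_bB_b`. -/
def smul (N : B.TwistModule b) (i j n : ℤ) (h : i + j = n) :
    B.gr i →ₗ[k] deg N j →ₗ[k] deg N n :=
  N.act (B.twist b).pt (B.twist b).pt i j n h

/-- The differential of a DG-module over `_bB_b`. -/
def diff (N : B.TwistModule b) (i : ℤ) : deg N i →ₗ[k] deg N (i + 1) := N.d (B.twist b).pt i

theorem diff_smul (N : B.TwistModule b) (i j n : ℤ) (h : i + j = n) (f : B.gr i) (x : deg N j) :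
    diff N n (smul N i j n h f x) =
      smul N (i + 1) j (n + 1) (by omega) (B.twistedD b b i f) x +
        koszulSign i • smul N i (j + 1) (n + 1) (by omega) f (diff N j x) :=
  N.leibniz (B.twist b).pt (B.twist b).pt i j n h f x

theorem diff_diff (N : B.TwistModule b) (i : ℤ) (x : deg N i) :
    diff N (i + 1) (diff N i x) = 0 :=
  N.d_d (B.twist b).pt i x

/-- The degree `n` part of the tensor product over `k` of the graded vector spaces `B` and `N`. -/
abbrev PreTensor (N : B.TwistModule b) (n : ℤ) : Type u :=
  ⨁ p : {p : ℤ × ℤ // p.1 + p.2 = n}, (B.gr p.1.1) ⊗[k] (deg N p.1.2)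

instance (N : B.TwistModule b) (n : ℤ) : AddCommGroup (PreTensor N n) :=
  Module.addCommMonoidToAddCommGroup k

/-- Pure tensors of bidegree `(i, j)`, in `PreTensor N n` where `n = i + j`. -/
def preTmul (N : B.TwistModule b) (i j n : ℤ) (h : i + j = n) :
    B.gr i →ₗ[k] deg N j →ₗ[k] PreTensor N n :=
  (TensorProduct.mk k (B.gr i) (deg N j)).compr₂
    (DirectSum.lof k {p : ℤ × ℤ // p.1 + p.2 = n}
      (fun p => (B.gr p.1.1) ⊗[k] (deg N p.1.2)) ⟨(i, j), h⟩)

/-- The relations `x r ⊗ y = x ⊗ r y` of the tensor product over `_bB_b`, in degree `n`. -/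
def tensorRel (N : B.TwistModule b) (n : ℤ) : Submodule k (PreTensor N n) :=
  Submodule.span k {t | ∃ (i j l ij jl : ℤ) (hij : i + j = ij) (hjl : j + l = jl)
    (h₁ : ij + l = n) (h₂ : i + jl = n) (x : B.gr i) (r : B.gr j) (y : deg N l),
    t = preTmul N ij l n h₁ (B.mul i j ij hij x r) y -
      preTmul N i jl n h₂ x (smul N j l jl hjl r y)}

/-- The degree `n` part of the tensor product `ₐB_b ⊗ N` over `_bB_b`; as a graded vector space it
does not depend on `a`. -/
abbrev Tensor (N : B.TwistModule b) (n : ℤ) : Type u := PreTensor N n ⧸ tensorRel N n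

/-- Pure tensors in the tensor product over `_bB_b`. -/
def tmul (N : B.TwistModule b) (i j n : ℤ) (h : i + j = n) :
    B.gr i →ₗ[k] deg N j →ₗ[k] Tensor N n :=
  (preTmul N i j n h).compr₂ (tensorRel N n).mkQ

theorem tmul_mul (N : B.TwistModule b) (i j l ij jl n : ℤ) (hij : i + j = ij) (hjl : j + l = jl)
    (h₁ : ij + l = n) (h₂ : i + jl = n) (x : B.gr i) (r : B.gr j) (y : deg N l) :
    tmul N ij l n h₁ (B.mul i j ij hij x r) y = tmul N i jl n h₂ x (smul N j l jl hjl r y) :=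
  (Submodule.Quotient.eq (tensorRel N n)).2
    (Submodule.subset_span ⟨i, j, l, ij, jl, hij, hjl, h₁, h₂, x, r, y, rfl⟩)

theorem tensor_ext {N : B.TwistModule b} {n : ℤ} {Z : Type*} [AddCommGroup Z] [Module k Z]
    {φ ψ : Tensor N n →ₗ[k] Z}
    (h : ∀ (i j : ℤ) (h : i + j = n) (x : B.gr i) (y : deg N j),
      φ (tmul N i j n h x y) = ψ (tmul N i j n h x y)) : φ = ψ := by
  apply Submodule.linearMap_qext
  apply DirectSum.linearMap_ext
  rintro ⟨⟨i, j⟩, hij⟩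
  apply TensorProduct.ext'
  intro x y
  exact h i j hij x y

/-- Linear maps out of the tensor product, from balanced families of bilinear maps. -/
def tensorLift (N : B.TwistModule b) {n : ℤ} {Z : Type*} [AddCommGroup Z] [Module k Z]
    (φ : ∀ i j : ℤ, i + j = n → B.gr i →ₗ[k] deg N j →ₗ[k] Z)
    (hφ : ∀ (i j l ij jl : ℤ) (hij : i + j = ij) (hjl : j + l = jl)
      (h₁ : ij + l = n) (h₂ : i + jl = n) (x : B.gr i) (r : B.gr j) (y : deg N l),
      φ ij l h₁ (B.mul i j ij hij x r) y = φ i jl h₂ x (smul N j l jl hjl r y)) :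
    Tensor N n →ₗ[k] Z :=
  (tensorRel N n).liftQ
    (DirectSum.toModule k _ _ fun p => TensorProduct.lift (φ p.1.1 p.1.2 p.2)) (by
      rw [tensorRel, Submodule.span_le]
      rintro _ ⟨i, j, l, ij, jl, hij, hjl, h₁, h₂, x, r, y, rfl⟩
      simp only [preTmul, SetLike.mem_coe, LinearMap.mem_ker, map_sub, LinearMap.compr₂_apply,
        TensorProduct.mk_apply, DirectSum.toModule_lof, TensorProduct.lift.tmul]
      exact sub_eq_zero.2 (hφ i j l ij jl hij hjl h₁ h₂ x r y))

@[simp]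
theorem tensorLift_tmul (N : B.TwistModule b) {n : ℤ} {Z : Type*} [AddCommGroup Z] [Module k Z]
    (φ : ∀ i j : ℤ, i + j = n → B.gr i →ₗ[k] deg N j →ₗ[k] Z) (hφ)
    (i j : ℤ) (h : i + j = n) (x : B.gr i) (y : deg N j) :
    tensorLift N φ hφ (tmul N i j n h x y) = φ i j h x y := by
  simp only [tensorLift, tmul, preTmul, LinearMap.compr₂_apply, Submodule.mkQ_apply,
    Submodule.liftQ_apply, TensorProduct.mk_apply, DirectSum.toModule_lof,
    TensorProduct.lift.tmul]

/-- The differential `x ⊗ y ↦ d x ⊗ y + (-1)^|x| x ⊗ d y` of `ₐB_b ⊗ N`, where `d x` is computed in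
`ₐB_b`. -/
def tensorD (N : B.TwistModule b) (a : B.MaurerCartan) (n : ℤ) :
    Tensor N n →ₗ[k] Tensor N (n + 1) :=
  tensorLift N
    (fun i j h => (tmul N (i + 1) j (n + 1) (by omega)).comp (B.twistedD a b i) +
      koszulSign i • (tmul N i (j + 1) (n + 1) (by omega)).compl₂ (diff N j))
    (by
      intro i j l ij jl hij hjl h₁ h₂ x r y
      have h : B.twistedD a b ij (B.mul i j ij hij x r) =
          B.mul (i + 1) j (ij + 1) (by omega) (B.twistedD a b i x) r +
            koszulSign i • B.mul i (j + 1) (ij + 1) (by omega) x (B.twistedD b b j r) :=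
        Subtype.ext (B.twistedD_mul a b b i j ij hij x r)
      simp only [LinearMap.add_apply, LinearMap.comp_apply, LinearMap.smul_apply,
        LinearMap.compl₂_apply, h, map_add, map_zsmul, diff_smul]
      rw [tmul_mul N (i + 1) j l (ij + 1) jl (n + 1) (by omega) hjl (by omega) (by omega),
        tmul_mul N i (j + 1) l (ij + 1) (jl + 1) (n + 1) (by omega) (by omega) (by omega)
          (by omega),
        tmul_mul N i j (l + 1) ij (jl + 1) (n + 1) hij (by omega) (by omega) (by omega)]
      subst hij
      simp only [koszulSign_add, smul_add, mul_smul]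
      abel)

theorem tensorD_tmul (N : B.TwistModule b) (a : B.MaurerCartan) (i j n : ℤ) (h : i + j = n)
    (x : B.gr i) (y : deg N j) :
    tensorD N a n (tmul N i j n h x y) =
      tmul N (i + 1) j (n + 1) (by omega) (B.twistedD a b i x) y +
        koszulSign i • tmul N i (j + 1) (n + 1) (by omega) x (diff N j y) := by
  simp [tensorD]

/-- Multiplication on the left by `f` on the tensor product. -/
def tensorMul (N : B.TwistModule b) (i j n : ℤ) (h : i + j = n) (f : B.gr i) :
    Tensor N j →ₗ[k] Tensor N n :=
  tensorLift N (fun p q hpq => (tmul N (i + p) q n (by omega)).comp (B.mul i p (i + p) rfl f)) (by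
    intro p q l pq ql hpq hql h₁ h₂ x r y
    have h : B.mul i pq (i + pq) rfl f (B.mul p q pq hpq x r) =
        B.mul (i + p) q (i + pq) (by omega) (B.mul i p (i + p) rfl f x) r :=
      Subtype.ext (mul_assoc _ _ _).symm
    simp only [LinearMap.comp_apply, h]
    rw [tmul_mul N (i + p) q l (i + pq) ql n (by omega) hql (by omega) (by omega)])

theorem tensorMul_tmul (N : B.TwistModule b) (i p q ip j n : ℤ) (h : i + j = n) (hpq : p + q = j)
    (hip : i + p = ip) (hn : ip + q = n) (f : B.gr i) (x : B.gr p) (y : deg N q) :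
    tensorMul N i j n h f (tmul N p q j hpq x y) =
      tmul N ip q n hn (B.mul i p ip hip f x) y := by
  subst hip
  simp [tensorMul]

/-- Multiplication on the left on the tensor product, as a bilinear map. -/
def tensorAct (N : B.TwistModule b) (i j n : ℤ) (h : i + j = n) :
    B.gr i →ₗ[k] Tensor N j →ₗ[k] Tensor N n where
  toFun := tensorMul N i j n h
  map_add' f g := tensor_ext fun p q hpq x y => by
    simp [tensorMul_tmul N i p q (i + p) j n h hpq rfl (by omega)]
  map_smul' c f := tensor_ext fun p q hpq x y => by
    simp [tensorMul_tmul N i p q (i + p) j n h hpq rfl (by omega)]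

theorem tensorAct_tmul (N : B.TwistModule b) (i p q ip j n : ℤ) (h : i + j = n) (hpq : p + q = j)
    (hip : i + p = ip) (hn : ip + q = n) (f : B.gr i) (x : B.gr p) (y : deg N q) :
    tensorAct N i j n h f (tmul N p q j hpq x y) =
      tmul N ip q n hn (B.mul i p ip hip f x) y :=
  tensorMul_tmul N i p q ip j n h hpq hip hn f x y

theorem tensorD_tensorD (N : B.TwistModule b) (a : B.MaurerCartan) (n : ℤ) (t : Tensor N n) :
    tensorD N a (n + 1) (tensorD N a n t) = 0 := by
  suffices h : (tensorD N a (n + 1)).comp (tensorD N a n) = 0 from LinearMap.congr_fun h t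
  refine tensor_ext fun i j h x y => ?_
  simp only [LinearMap.comp_apply, tensorD_tmul, map_add, map_zsmul, twistedD_twistedD, diff_diff,
    map_zero, LinearMap.zero_apply, koszulSign_succ, smul_zero, neg_smul]
  abel

theorem one_tensorAct (N : B.TwistModule b) (n : ℤ) (t : Tensor N n) :
    tensorAct N 0 n n (zero_add n) ⟨1, SetLike.one_mem_graded B.gr⟩ t = t := by
  suffices h : tensorAct N 0 n n (zero_add n) ⟨1, SetLike.one_mem_graded B.gr⟩ = LinearMap.id from
    LinearMap.congr_fun h t
  refine tensor_ext fun i j h x y => ?_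
  rw [tensorAct_tmul N 0 i j i n n (zero_add n) h (zero_add i) h]
  have h : B.mul 0 i i (zero_add i) ⟨1, SetLike.one_mem_graded B.gr⟩ x = x :=
    Subtype.ext (one_mul _)
  rw [h, LinearMap.id_apply]

theorem mul_tensorAct (N : B.TwistModule b) (i j l ij jl n : ℤ) (hij : i + j = ij)
    (hjl : j + l = jl) (h₁ : ij + l = n) (h₂ : i + jl = n) (f : B.gr i) (g : B.gr j)
    (t : Tensor N l) :
    tensorAct N ij l n h₁ (B.mul i j ij hij f g) t =
      tensorAct N i jl n h₂ f (tensorAct N j l jl hjl g t) := by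
  suffices h : tensorAct N ij l n h₁ (B.mul i j ij hij f g) =
      (tensorAct N i jl n h₂ f).comp (tensorAct N j l jl hjl g) from LinearMap.congr_fun h t
  refine tensor_ext fun p q h x y => ?_
  rw [LinearMap.comp_apply,
    tensorAct_tmul N ij p q (ij + p) l n h₁ h rfl (by omega),
    tensorAct_tmul N j p q (j + p) l jl hjl h rfl (by omega),
    tensorAct_tmul N i (j + p) q (ij + p) jl n h₂ (by omega) (by omega) (by omega)]
  have h : B.mul ij p (ij + p) rfl (B.mul i j ij hij f g) x =
      B.mul i (j + p) (ij + p) (by omega) f (B.mul j p (j + p) rfl g x) :=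
    Subtype.ext (mul_assoc _ _ _)
  rw [h]

theorem tensorD_tensorAct (N : B.TwistModule b) (a c : B.MaurerCartan) (i j n : ℤ) (h : i + j = n)
    (f : B.gr i) (t : Tensor N j) :
    tensorD N a n (tensorAct N i j n h f t) =
      tensorAct N (i + 1) j (n + 1) (by omega) (B.twistedD a c i f) t +
        koszulSign i • tensorAct N i (j + 1) (n + 1) (by omega) f (tensorD N c j t) := by
  suffices h : (tensorD N a n).comp (tensorAct N i j n h f) =
      tensorAct N (i + 1) j (n + 1) (by omega) (B.twistedD a c i f) +
        koszulSign i • (tensorAct N i (j + 1) (n + 1) (by omega) f).comp (tensorD N c j) from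
    LinearMap.congr_fun h t
  refine tensor_ext fun p q hpq x y => ?_
  simp only [LinearMap.comp_apply, LinearMap.add_apply, LinearMap.smul_apply, tensorD_tmul,
    map_add, map_zsmul]
  rw [tensorAct_tmul N i p q (i + p) j n h hpq rfl (by omega),
    tensorAct_tmul N (i + 1) p q (i + p + 1) j (n + 1) (by omega) hpq (by omega) (by omega),
    tensorAct_tmul N i (p + 1) q (i + p + 1) (j + 1) (n + 1) (by omega) (by omega) (by omega)
      (by omega),
    tensorAct_tmul N i p (q + 1) (i + p) (j + 1) (n + 1) (by omega) (by omega) rfl (by omega),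
    tensorD_tmul]
  have h : B.twistedD a b (i + p) (B.mul i p (i + p) rfl f x) =
      B.mul (i + 1) p (i + p + 1) (by omega) (B.twistedD a c i f) x +
        koszulSign i • B.mul i (p + 1) (i + p + 1) (by omega) f (B.twistedD c b p x) :=
    Subtype.ext (B.twistedD_mul a c b i p _ rfl f x)
  rw [h, koszulSign_add]
  simp only [map_add, map_zsmul, LinearMap.add_apply, LinearMap.smul_apply, smul_add, mul_smul]
  abel

/-- The map `id ⊗ φ` on tensor products. -/
def tensorMap {N N' : B.TwistModule b} (φ : N ⟶ N') (n : ℤ) : Tensor N n →ₗ[k] Tensor N' n :=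
  tensorLift N (fun i j h => (tmul N' i j n h).compl₂ (φ.app (B.twist b).pt j)) (by
    intro i j l ij jl hij hjl h₁ h₂ x r y
    have h : φ.app (B.twist b).pt jl (smul N j l jl hjl r y) =
        smul N' j l jl hjl r (φ.app (B.twist b).pt l y) :=
      φ.app_act (B.twist b).pt (B.twist b).pt j l jl hjl r y
    simp only [LinearMap.compl₂_apply, h]
    exact tmul_mul N' i j l ij jl n hij hjl h₁ h₂ x r _)

theorem tensorMap_tmul {N N' : B.TwistModule b} (φ : N ⟶ N') (i j n : ℤ) (h : i + j = n)
    (x : B.gr i) (y : deg N j) :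
    tensorMap φ n (tmul N i j n h x y) = tmul N' i j n h x (φ.app (B.twist b).pt j y) := by
  simp [tensorMap]

theorem tensorMap_tensorD {N N' : B.TwistModule b} (φ : N ⟶ N') (a : B.MaurerCartan) (n : ℤ)
    (t : Tensor N n) :
    tensorMap φ (n + 1) (tensorD N a n t) = tensorD N' a n (tensorMap φ n t) := by
  suffices h : (tensorMap φ (n + 1)).comp (tensorD N a n) =
      (tensorD N' a n).comp (tensorMap φ n) from LinearMap.congr_fun h t
  refine tensor_ext fun i j h x y => ?_
  have h : φ.app (B.twist b).pt (j + 1) (diff N j y) =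
      diff N' j (φ.app (B.twist b).pt j y) := φ.app_d (B.twist b).pt j y
  simp only [LinearMap.comp_apply, tensorD_tmul, tensorMap_tmul, map_add, map_zsmul, h]

theorem tensorMap_tensorAct {N N' : B.TwistModule b} (φ : N ⟶ N') (i j n : ℤ) (h : i + j = n)
    (f : B.gr i) (t : Tensor N j) :
    tensorMap φ n (tensorAct N i j n h f t) = tensorAct N' i j n h f (tensorMap φ j t) := by
  suffices h : (tensorMap φ n).comp (tensorAct N i j n h f) =
      (tensorAct N' i j n h f).comp (tensorMap φ j) from LinearMap.congr_fun h t
  refine tensor_ext fun p q hpq x y => ?_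
  rw [LinearMap.comp_apply, LinearMap.comp_apply, tensorMap_tmul,
    tensorAct_tmul N i p q (i + p) j n h hpq rfl (by omega),
    tensorAct_tmul N' i p q (i + p) j n h hpq rfl (by omega), tensorMap_tmul]

end TwistModule

open TwistModule in
/-- The functor `N ↦ (a ↦ ₐB_b ⊗ N)` (tensor product over `_bB_b`) from DG-modules over `_bB_b` to
DG-modules over `MC(B)`; morphisms `f` in `MC(B)` act by multiplication on the left. -/
def induce (B : DGAlgebra.{w, u} k) (b : B.MaurerCartan) : B.TwistModule b ⥤ DGModule B.MC where
  obj N :=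
    { X := fun _ n => Tensor N n
      d := fun a n => tensorD N a n
      d_d := fun a n t => tensorD_tensorD N a n t
      act := fun _ _ i j n h => tensorAct N i j n h
      one_act := fun _ n t => one_tensorAct N n t
      comp_act := fun _ _ _ => mul_tensorAct N
      leibniz := fun a c => tensorD_tensorAct N a c }
  map {N N'} φ :=
    { app := fun _ n => tensorMap φ n
      app_d := fun a n t => tensorMap_tensorD φ a n t
      app_act := fun _ _ i j n h f t => tensorMap_tensorAct φ i j n h f t }
  map_id N := DGModule.Hom.ext (funext fun _ => funext fun n => tensor_ext fun i j h x y =>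
    tensorMap_tmul _ i j n h x y)
  map_comp {N N' N''} φ ψ := DGModule.Hom.ext (funext fun _ => funext fun n =>
    tensor_ext fun i j h x y => by
      change tensorMap (φ ≫ ψ) n (tmul N i j n h x y) =
        tensorMap ψ n (tensorMap φ n (tmul N i j n h x y))
      simp only [tensorMap_tmul]
      rfl)

end DGAlgebra

/-! For any two Maurer–Cartan elements `a`, `c` the unit `1 ∈ B^0` is a morphism between them in
`MC(B)`. It is not closed, since its differential in `ₐB_c` is `a - c`, but it is invertible, with
inverse the unit in the other direction. So for a DG-module `M` over `MC(B)` the action of `1`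
identifies `M(b)` with `M(a)` as graded spaces, and by the Leibniz rule it carries the differential
`d + (a - b)` of `M(b)` to that of `M(a)`.

Conversely, `a - b` is a Maurer–Cartan element of `_bB_b`, so for every DG-module `N` over `_bB_b`
the map `d + (a - b)` squares to zero and makes `N` the value at `a` of a DG-module over `MC(B)`:
this is `extend`. Restriction to `b` and `extend` are thus quasi-inverse already on DG-modules
(`restrictExtend`, `extendRestrict`). The action map `x ⊗ y ↦ xy` identifies `induce` with `extend`
(`induceIsoExtend`), as `ₐB_b` is the free graded right module on `1`.

It remains to descend to coderived categories. Exactness of a triple concerns only the underlying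
graded spaces, which `extend` repeats unchanged at every object; cones, shifts, direct sums and
homotopies are respected because they are linear over the element `a - b`, with the appropriate
signs. Hence both functors preserve coacyclic modules (`coacyclicFunctor_restrict`,
`coacyclicFunctor_extend`) and pass to the Verdier quotients. -/

namespace DGModule

/-! ### Functors that preserve coacyclic modules, and the functors they induce on coderived
categories. -/

variable {k : Type w} [Field k]

/-- A closed morphism of degree `0` whose components have linear inverses is an isomorphism. -/
def isoOfInverse {A : DGCategory.{w, v, u} k} {M N : DGModule A} (φ : M ⟶ N)
    (ψ : ∀ a i, N.X a i →ₗ[k] M.X a i)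
    (h₁ : ∀ a i x, ψ a i (φ.app a i x) = x) (h₂ : ∀ a i y, φ.app a i (ψ a i y) = y) : M ≅ N where
  hom := φ
  inv :=
    { app := ψ
      -- Compatibility of the inverse with differential and action is automatic: write each argument
      -- as an image under `φ`. Below, only the more convenient direction has to be checked.
      app_d := fun a i x => by rw [← h₂ a i x, ← φ.app_d, h₁, h₁]
      app_act := fun a b i j n h f x => by rw [← h₂ b j x, ← φ.app_act, h₁, h₁] }
  hom_inv_id := Hom.ext (funext fun a => funext fun i => LinearMap.ext (h₁ a i))
  inv_hom_id := Hom.ext (funext fun a => funext fun i => LinearMap.ext (h₂ a i))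

variable {A : DGCategory.{w, v, u} k} {A' : DGCategory.{w, v, u} k}

/-- Isomorphic DG-modules are coacyclic simultaneously. -/
theorem IsCoacyclic.ofIso {M N : DGModule A} (e : M ≅ N) (hM : IsCoacyclic M) : IsCoacyclic N :=
  .iso ((toHo A).mapIso e) hM

/-- A functor between categories of DG-modules preserving homotopies and the constructions from
which coacyclic DG-modules are built. -/
structure CoacyclicFunctor (F : DGModule A ⥤ DGModule A') : Prop where
  homotopic {M N : DGModule A} (φ ψ : M ⟶ N) :
    DGModule.homotopic A φ ψ → DGModule.homotopic A' (F.map φ) (F.map ψ)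
  -- Coacyclicity suffices here because totalizations are a base case of the induction; the
  -- remaining constructions are inductive steps and have to be matched up to isomorphism.
  tot (T : ExactTriple A) : IsCoacyclic (F.obj T.tot)
  directSum {S : Type u} (M : S → DGModule A) :
    Nonempty (DGModule.directSum (fun s => F.obj (M s)) ≅ F.obj (DGModule.directSum M))
  cone {M N : DGModule A} (φ : M ⟶ N) :
    Nonempty (DGModule.cone (F.map φ) ≅ F.obj (DGModule.cone φ))
  shift (M : DGModule A) : Nonempty ((F.obj M).shift ≅ F.obj M.shift)

namespace CoacyclicFunctor

variable {F : DGModule A ⥤ DGModule A'} (hF : CoacyclicFunctor F)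

/-- The functor induced on homotopy categories. -/
def mapHo : Ho A ⥤ Ho A' :=
  CategoryTheory.Quotient.lift (DGModule.homotopic A) (F ⋙ toHo A') fun _ _ φ ψ h =>
    CategoryTheory.Quotient.sound _ (hF.homotopic φ ψ h)

-- Induction on how the module is built. The `unshift` case uses the shift isomorphism backwards,
-- and the `iso` case needs the functor on homotopy categories, since there the isomorphism holds
-- only up to homotopy.
include hF in
theorem isCoacyclic {M : DGModule A} (hM : IsCoacyclic M) : IsCoacyclic (F.obj M) := by
  induction hM with
  | tot T => exact hF.tot T
  | directSum M _ ih => exact .ofIso (hF.directSum M).some (.directSum _ ih)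
  | cone φ _ _ ihM ihN => exact .ofIso (hF.cone φ).some (.cone _ ihM ihN)
  | shift M _ ih => exact .ofIso (hF.shift M).some (.shift _ ih)
  | unshift M _ ih => exact .unshift _ (.ofIso (hF.shift M).some.symm ih)
  | iso e _ ih => exact .iso (hF.mapHo.mapIso e) ih

/-- The cone of `F.map f` is the image of the cone of `f`, hence coacyclic. -/
theorem inverts : (coacyclicW A).IsInvertedBy (hF.mapHo ⋙ (coacyclicW A').Q) := by
  rintro X Y _ ⟨f, rfl, hf⟩
  exact Localization.inverts (coacyclicW A').Q (coacyclicW A') _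
    ⟨F.map f, rfl, .ofIso (hF.cone f).some.symm (hF.isCoacyclic hf)⟩

/-- The functor induced on coderived categories. -/
noncomputable def mapDco : Dco A ⥤ Dco A' :=
  Localization.lift (hF.mapHo ⋙ (coacyclicW A').Q) hF.inverts (coacyclicW A).Q

/-- Compatibility of `mapDco` with the localization functors. -/
noncomputable def mapDcoFac : (coacyclicW A).Q ⋙ hF.mapDco ≅ hF.mapHo ⋙ (coacyclicW A').Q :=
  Localization.fac _ _ _

/-- Quasi-inverse functors on DG-modules induce quasi-inverse functors on homotopy categories. -/
def mapHoIso {G : DGModule A' ⥤ DGModule A} (hG : CoacyclicFunctor G)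
    (η : F ⋙ G ≅ 𝟭 (DGModule A)) : hF.mapHo ⋙ hG.mapHo ≅ 𝟭 (Ho A) :=
  CategoryTheory.Quotient.natIsoLift _ (Functor.isoWhiskerRight η (toHo A))

/-- Compatibility of `mapDco` with the functors from DG-modules to coderived categories. -/
noncomputable def toDcoIso : toDco A ⋙ hF.mapDco ≅ F ⋙ toDco A' :=
  Functor.isoWhiskerLeft (toHo A) hF.mapDcoFac

/-- Quasi-inverse functors on DG-modules that preserve coacyclicity induce an equivalence of
coderived categories. -/
noncomputable def equivalence {G : DGModule A' ⥤ DGModule A} (hG : CoacyclicFunctor G)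
    (η : F ⋙ G ≅ 𝟭 (DGModule A)) (ε : G ⋙ F ≅ 𝟭 (DGModule A')) : Dco A ≌ Dco A' :=
  letI : Localization.Lifting (coacyclicW A).Q (coacyclicW A) (hF.mapHo ⋙ (coacyclicW A').Q)
    hF.mapDco := ⟨hF.mapDcoFac⟩
  letI : Localization.Lifting (coacyclicW A').Q (coacyclicW A') (hG.mapHo ⋙ (coacyclicW A).Q)
    hG.mapDco := ⟨hG.mapDcoFac⟩
  Localization.equivalence (coacyclicW A).Q (coacyclicW A) (coacyclicW A').Q (coacyclicW A')
    (hF.mapHo ⋙ (coacyclicW A').Q) hF.mapDco (hG.mapHo ⋙ (coacyclicW A).Q) hG.mapDco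
    -- Both required isomorphisms are pulled back along the localization functors to the homotopy
    -- categories, where they come from `η` and `ε`.
    (Functor.isoWhiskerLeft hF.mapHo hG.mapDcoFac ≪≫
      Functor.isoWhiskerRight (hF.mapHoIso hG η) (coacyclicW A).Q)
    (Functor.isoWhiskerLeft hG.mapHo hF.mapDcoFac ≪≫
      Functor.isoWhiskerRight (hG.mapHoIso hF ε) (coacyclicW A').Q)

end CoacyclicFunctor

end DGModule

/-! ### Restriction to `b` preserves coacyclicity. -/

namespace DGAlgebra

variable {k : Type w} [Field k]

open DGModule

variable {B : DGAlgebra.{w, u} k} {b : B.MaurerCartan}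

/-- The exact triple of values at `b`. -/
def restrictTriple (b : B.MaurerCartan) (T : ExactTriple B.MC) :
    ExactTriple (B.twist b).toDGCategory where
  K := (B.restrict b).obj T.K
  L := (B.restrict b).obj T.L
  M := (B.restrict b).obj T.M
  ι := (B.restrict b).map T.ι
  π := (B.restrict b).map T.π
  injective _ i := T.injective b.toObj i
  exact _ i := T.exact b.toObj i
  surjective _ i := T.surjective b.toObj i

/-- All the constructions are objectwise, so they commute with evaluation at `b` on the nose. -/
theorem coacyclicFunctor_restrict (b : B.MaurerCartan) : CoacyclicFunctor (B.restrict b) where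
  homotopic φ ψ := by
    rintro ⟨h⟩
    exact ⟨{ s := fun _ i => h.s b.toObj i
             s_act := fun _ _ => h.s_act b.toObj b.toObj
             eq := fun _ => h.eq b.toObj }⟩
  tot T := .tot (restrictTriple b T)
  directSum M := ⟨Iso.refl _⟩
  cone φ := ⟨Iso.refl _⟩
  shift M := ⟨Iso.refl _⟩

/-! ### Twisting differentials by `a - b`. -/

namespace TwistModule

/-- The difference `a - b` of Maurer–Cartan elements, the differential of `1` in `ₐB_b`. -/
def diffMC (a b : B.MaurerCartan) : B.gr 1 := a.1 - b.1

theorem coe_diffMC (a b : B.MaurerCartan) : (diffMC a b : B.carrier) = a.val - b.val := rfl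

theorem coe_d_val (a : B.MaurerCartan) : (B.d 1 a.1 : B.carrier) = -(a.val * a.val) :=
  eq_neg_of_add_eq_zero_left a.2

/-- For `x = a - b` the left side is the difference of `d(b + x) + (b + x)^2` and `db + b^2`, both
of which vanish. -/
theorem twistedD_diffMC (a b : B.MaurerCartan) :
    B.twistedD b b 1 (diffMC a b) + B.mul 1 1 (1 + 1) rfl (diffMC a b) (diffMC a b) = 0 := by
  have h1 : koszulSign 1 = -1 := by simp [koszulSign]
  have hd : (B.d 1 (diffMC a b) : B.carrier) = -(a.val * a.val) + b.val * b.val := by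
    rw [diffMC, map_sub, AddSubgroupClass.coe_sub, coe_d_val, coe_d_val]
    abel
  apply Subtype.ext
  rw [Submodule.coe_add, coe_twistedD, coe_mul, hd, coe_diffMC, h1]
  simp only [mul_sub, sub_mul, neg_smul, one_smul, Submodule.coe_zero]
  abel

/-- Expresses every Hom-complex of `MC(B)` through the differential of `_bB_b`, the only one that a
module over `_bB_b` knows about. -/
theorem twistedD_eq_twistedD (a c b : B.MaurerCartan) (i : ℤ) (f : B.gr i) :
    B.twistedD a c i f = B.twistedD b b i f + B.mul 1 i (i + 1) (add_comm 1 i) (diffMC a b) f -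
      koszulSign i • B.mul i 1 (i + 1) rfl f (diffMC c b) := by
  apply Subtype.ext
  simp only [coe_twistedD, Submodule.coe_add, AddSubgroupClass.coe_sub,
    AddSubgroupClass.coe_zsmul, coe_mul, coe_diffMC, mul_sub, sub_mul, smul_sub]
  abel

theorem mul_smul' (N : B.TwistModule b) (i j l ij jl n : ℤ) (hij : i + j = ij) (hjl : j + l = jl)
    (h₁ : ij + l = n) (h₂ : i + jl = n) (f : B.gr i) (g : B.gr j) (x : deg N l) :
    smul N ij l n h₁ (B.mul i j ij hij f g) x = smul N i jl n h₂ f (smul N j l jl hjl g x) :=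
  N.comp_act (B.twist b).pt (B.twist b).pt (B.twist b).pt i j l ij jl n hij hjl h₁ h₂ f g x

/-- The differential `x ↦ d x + (a - b) x` on a DG-module over `_bB_b`. -/
def twistedDiff (N : B.TwistModule b) (a : B.MaurerCartan) (i : ℤ) : deg N i →ₗ[k] deg N (i + 1) :=
  diff N i + smul N 1 i (i + 1) (add_comm 1 i) (diffMC a b)

theorem twistedDiff_apply (N : B.TwistModule b) (a : B.MaurerCartan) (i : ℤ) (x : deg N i) :
    twistedDiff N a i x = diff N i x + smul N 1 i (i + 1) (add_comm 1 i) (diffMC a b) x := rfl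

theorem twistedDiff_self (N : B.TwistModule b) (i : ℤ) (x : deg N i) :
    twistedDiff N b i x = diff N i x := by
  have h : diffMC b b = 0 := sub_self _
  rw [twistedDiff_apply, h, map_zero, LinearMap.zero_apply, add_zero]

/-- The Leibniz rule gives `(d + x)^2 = d(x) + x^2` for `x = a - b`, the cross terms cancelling
because `x` has odd degree; then `twistedD_diffMC` applies. -/
theorem twistedDiff_twistedDiff (N : B.TwistModule b) (a : B.MaurerCartan) (i : ℤ) (x : deg N i) :
    twistedDiff N a (i + 1) (twistedDiff N a i x) = 0 := by
  have h1 : koszulSign 1 = -1 := by simp [koszulSign]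
  have h := congrArg (fun f => smul N (1 + 1) i (i + 1 + 1) (by omega) f x)
    (twistedD_diffMC a b)
  simp only [map_add, LinearMap.add_apply, map_zero, LinearMap.zero_apply] at h
  rw [mul_smul' N 1 1 i (1 + 1) (i + 1) (i + 1 + 1) rfl (by omega) (by omega) (by omega)] at h
  simp only [twistedDiff_apply, map_add, diff_diff]
  rw [diff_smul, h1, neg_smul, one_smul]
  refine Eq.trans ?_ h
  abel

/-- The term of the differential of `f` ending in `c - b` cancels the correction in `twistedDiff N
c`, and the term beginning with `a - b` is the correction in `twistedDiff N a`. -/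
theorem twistedDiff_smul (N : B.TwistModule b) (a c : B.MaurerCartan) (i j n : ℤ) (h : i + j = n)
    (f : B.gr i) (x : deg N j) :
    twistedDiff N a n (smul N i j n h f x) =
      smul N (i + 1) j (n + 1) (by omega) (B.twistedD a c i f) x +
        koszulSign i • smul N i (j + 1) (n + 1) (by omega) f (twistedDiff N c j x) := by
  rw [twistedDiff_apply, twistedDiff_apply, diff_smul, twistedD_eq_twistedD a c b]
  simp only [map_add, map_sub, map_zsmul, LinearMap.add_apply, LinearMap.sub_apply,
    LinearMap.smul_apply, smul_add]
  rw [mul_smul' N 1 i j (i + 1) n (n + 1) (by omega) h (by omega) (by omega),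
    mul_smul' N i 1 j (i + 1) (j + 1) (n + 1) rfl (by omega) (by omega) (by omega)]
  abel

theorem app_diff {N N' : B.TwistModule b} (φ : N ⟶ N') (i : ℤ) (x : deg N i) :
    φ.app (B.twist b).pt (i + 1) (diff N i x) = diff N' i (φ.app (B.twist b).pt i x) :=
  φ.app_d (B.twist b).pt i x

theorem app_smul {N N' : B.TwistModule b} (φ : N ⟶ N') (i j n : ℤ) (h : i + j = n) (f : B.gr i)
    (x : deg N j) : φ.app (B.twist b).pt n (smul N i j n h f x) =
      smul N' i j n h f (φ.app (B.twist b).pt j x) :=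
  φ.app_act (B.twist b).pt (B.twist b).pt i j n h f x

theorem app_twistedDiff {N N' : B.TwistModule b} (φ : N ⟶ N') (a : B.MaurerCartan) (i : ℤ)
    (x : deg N i) : φ.app (B.twist b).pt (i + 1) (twistedDiff N a i x) =
      twistedDiff N' a i (φ.app (B.twist b).pt i x) := by
  rw [twistedDiff_apply, twistedDiff_apply, map_add, app_diff, app_smul]

end TwistModule

/-! ### The extension functor, quasi-inverse to restriction. -/

open TwistModule

/-- The extension of a DG-module `N` over `_bB_b` to a DG-module over `MC(B)` with the underlying
graded vector space `N` at every object, and with the differential `x ↦ d x + (a - b) x` at `a`. -/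
def extend (b : B.MaurerCartan) : B.TwistModule b ⥤ DGModule B.MC where
  obj N :=
    { X := fun _ i => deg N i
      d := fun a i => twistedDiff N a i
      d_d := fun a i x => twistedDiff_twistedDiff N a i x
      act := fun _ _ i j n h => smul N i j n h
      one_act := fun _ i x => N.one_act (B.twist b).pt i x
      comp_act := fun _ _ _ => mul_smul' N
      leibniz := fun a c => twistedDiff_smul N a c }
  map φ :=
    { app := fun _ i => φ.app (B.twist b).pt i
      app_d := fun a i x => app_twistedDiff φ a i x
      app_act := fun _ _ i j n h f x => app_smul φ i j n h f x }

/-- Extending to `MC(B)` and evaluating at `b` is the identity. -/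
def extendRestrict (b : B.MaurerCartan) :
    extend b ⋙ B.restrict b ≅ 𝟭 (B.TwistModule b) :=
  NatIso.ofComponents (fun N => isoOfInverse
    { app := fun _ i => (LinearMap.id : deg N i →ₗ[k] deg N i)
      -- At `b` the differential is corrected by `b - b = 0`; this is a proved equation, whence an
      -- isomorphism of functors rather than an equality.
      app_d := fun _ i x => twistedDiff_self N i x
      app_act := fun _ _ _ _ _ _ _ _ => rfl }
    (fun _ i => (LinearMap.id : deg N i →ₗ[k] deg N i)) (fun _ _ _ => rfl) (fun _ _ _ => rfl))
    (fun _ => rfl)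

/-- The unit of `B` in degree `0`. -/
def unit (B : DGAlgebra.{w, u} k) : B.gr 0 := ⟨1, SetLike.one_mem_graded B.gr⟩

theorem unit_mul (i : ℤ) (x : B.gr i) : B.mul 0 i i (zero_add i) B.unit x = x :=
  Subtype.ext (one_mul _)

theorem mul_unit (i : ℤ) (x : B.gr i) : B.mul i 0 i (add_zero i) x B.unit = x :=
  Subtype.ext (mul_one _)

theorem coe_d_unit : (B.d 0 B.unit : B.carrier) = 0 := by
  have h := B.d_mul 0 0 0 rfl B.unit B.unit
  rw [unit_mul, koszulSign_zero, one_smul] at h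
  simpa [unit] using h

/-- The right side is kept as a product with the unit so that, acting on a module, it can be
factored through the endomorphism `a - c` of the object `c`. -/
theorem twistedD_unit (a c : B.MaurerCartan) :
    B.twistedD a c 0 B.unit = B.mul 0 1 (0 + 1) rfl B.unit (diffMC a c) := by
  apply Subtype.ext
  rw [coe_twistedD, coe_d_unit, koszulSign_zero, coe_mul, coe_diffMC]
  simp [unit]

/-- The action of elements of `ₐB_c` on a DG-module over `MC(B)`. -/
def mcAct (M : DGModule B.MC) (a c : B.MaurerCartan) (i j n : ℤ) (h : i + j = n) :
    B.gr i →ₗ[k] M.X c.toObj j →ₗ[k] M.X a.toObj n :=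
  M.act a.toObj c.toObj i j n h

/-- The product `f g` in `B` does not remember the middle object `c`, so one element may be factored
through any object. The next lemmas rest on this freedom. -/
theorem mcAct_mul (M : DGModule B.MC) (a c e : B.MaurerCartan) (i j l ij jl n : ℤ)
    (hij : i + j = ij) (hjl : j + l = jl) (h₁ : ij + l = n) (h₂ : i + jl = n) (f : B.gr i)
    (g : B.gr j) (x : M.X e.toObj l) :
    mcAct M a e ij l n h₁ (B.mul i j ij hij f g) x =
      mcAct M a c i jl n h₂ f (mcAct M c e j l jl hjl g x) :=
  M.comp_act a.toObj c.toObj e.toObj i j l ij jl n hij hjl h₁ h₂ f g x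

theorem mcAct_unit_unit (M : DGModule B.MC) (a c : B.MaurerCartan) (i : ℤ) (x : M.X a.toObj i) :
    mcAct M a c 0 i i (zero_add i) B.unit (mcAct M c a 0 i i (zero_add i) B.unit x) = x := by
  rw [← mcAct_mul M a c a 0 0 i 0 i i rfl (zero_add i), unit_mul]
  exact M.one_act a.toObj i x

/-- The Leibniz rule for `1 ∈ ₐB_b` reads `d(1 x) = (a - b) x + 1 (d x)`, and `a - b` equals `1`
composed with the endomorphism `a - b` of `b`. -/
theorem mcAct_unit_twistedDiff (M : DGModule B.MC) (a : B.MaurerCartan) (i : ℤ)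
    (x : M.X b.toObj i) :
    mcAct M a b 0 (i + 1) (i + 1) (zero_add _) B.unit
        (twistedDiff ((B.restrict b).obj M) a i x) =
      M.d a.toObj i (mcAct M a b 0 i i (zero_add i) B.unit x) := by
  have h := M.leibniz a.toObj b.toObj 0 i i (zero_add i) B.unit x
  have h' : B.MC.d a.toObj b.toObj 0 B.unit =
    B.mul 0 1 (0 + 1) rfl B.unit (diffMC a b) := twistedD_unit a b
  refine Eq.trans ?_ h.symm
  rw [h', koszulSign_zero, one_smul]
  change mcAct M a b 0 (i + 1) (i + 1) (zero_add _) B.unit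
    (M.d b.toObj i x + mcAct M b b 1 i (i + 1) (add_comm 1 i) (diffMC a b) x) =
    mcAct M a b (0 + 1) i (i + 1) (by omega) (B.mul 0 1 (0 + 1) rfl B.unit (diffMC a b)) x +
    mcAct M a b 0 (i + 1) (i + 1) (zero_add _) B.unit (M.d b.toObj i x)
  rw [mcAct_mul M a b b 0 1 i (0 + 1) (i + 1) (i + 1) rfl (add_comm 1 i) (by omega) (by omega),
    map_add]
  exact add_comm _ _

/-- Both sides are the action of `f` seen in `ₐB_b`, factored as `1 f` through `b` on the left and
as `f 1` through `c` on the right. -/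
theorem mcAct_unit_mcAct (M : DGModule B.MC) (a c : B.MaurerCartan) (i j n : ℤ) (h : i + j = n)
    (f : B.gr i) (x : M.X b.toObj j) :
    mcAct M a b 0 n n (zero_add n) B.unit (mcAct M b b i j n h f x) =
      mcAct M a c i j n h f (mcAct M c b 0 j j (zero_add j) B.unit x) := by
  rw [← mcAct_mul M a b b 0 i j i n n (zero_add i) h h, ← mcAct_mul M a c b i 0 j i j n
    (add_zero i) (zero_add j) h, unit_mul, mul_unit]

/-- A DG-module over `MC(B)` is determined by its value at `b`. -/
def restrictExtend (b : B.MaurerCartan) : B.restrict b ⋙ extend b ≅ 𝟭 (DGModule B.MC) :=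
  NatIso.ofComponents (fun M => isoOfInverse
    { app := fun a i => mcAct M a b 0 i i (zero_add i) B.unit
      app_d := fun a i x => mcAct_unit_twistedDiff M a i x
      app_act := fun a c i j n h f x => mcAct_unit_mcAct M a c i j n h f x }
    (fun a i => mcAct M b a 0 i i (zero_add i) B.unit)
    (fun a i x => mcAct_unit_unit M b a i x) (fun a i x => mcAct_unit_unit M a b i x))
    -- Naturality says that `φ` commutes with the action of `1`.
    (fun φ => Hom.ext (funext fun a => funext fun i => LinearMap.ext fun x =>
      (φ.app_act a b.toObj 0 i i (zero_add i) B.unit x).symm))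

/-! ### The tensor product `ₐB_b ⊗ N` is the extension of `N`. -/

namespace TwistModule

/-- The action map `ₐB_b ⊗ N → N`. -/
def tensorEval (N : B.TwistModule b) (n : ℤ) : Tensor N n →ₗ[k] deg N n :=
  tensorLift N (fun i j h => smul N i j n h) fun i j l ij jl hij hjl h₁ h₂ x r y =>
    mul_smul' N i j l ij jl n hij hjl h₁ h₂ x r y

theorem tensorEval_tmul (N : B.TwistModule b) (i j n : ℤ) (h : i + j = n) (x : B.gr i)
    (y : deg N j) : tensorEval N n (tmul N i j n h x y) = smul N i j n h x y :=
  tensorLift_tmul N _ _ i j h x y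

/-- On pure tensors this is the Leibniz rule `twistedDiff_smul` with `c = b`, where the inner
differential is untwisted. -/
theorem tensorEval_tensorD (N : B.TwistModule b) (a : B.MaurerCartan) (n : ℤ) (t : Tensor N n) :
    tensorEval N (n + 1) (tensorD N a n t) = twistedDiff N a n (tensorEval N n t) := by
  suffices h : (tensorEval N (n + 1)).comp (tensorD N a n) =
      (twistedDiff N a n).comp (tensorEval N n) from LinearMap.congr_fun h t
  refine tensor_ext fun i j h x y => ?_
  rw [LinearMap.comp_apply, LinearMap.comp_apply, tensorEval_tmul, tensorD_tmul, map_add,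
    map_zsmul, tensorEval_tmul, tensorEval_tmul, twistedDiff_smul N a b, twistedDiff_self]

theorem tensorEval_tensorAct (N : B.TwistModule b) (i j n : ℤ) (h : i + j = n) (f : B.gr i)
    (t : Tensor N j) :
    tensorEval N n (tensorAct N i j n h f t) = smul N i j n h f (tensorEval N j t) := by
  suffices h : (tensorEval N n).comp (tensorAct N i j n h f) =
      (smul N i j n h f).comp (tensorEval N j) from LinearMap.congr_fun h t
  refine tensor_ext fun p q hpq x y => ?_
  rw [LinearMap.comp_apply, LinearMap.comp_apply, tensorEval_tmul,
    tensorAct_tmul N i p q (i + p) j n h hpq rfl (by omega), tensorEval_tmul,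
    mul_smul' N i p q (i + p) j n rfl hpq (by omega) h]

/-- The balancing relation gives `1 ⊗ x y = x ⊗ y`. -/
theorem tmul_unit_tensorEval (N : B.TwistModule b) (n : ℤ) (t : Tensor N n) :
    tmul N 0 n n (zero_add n) B.unit (tensorEval N n t) = t := by
  suffices h : (tmul N 0 n n (zero_add n) B.unit).comp (tensorEval N n) = LinearMap.id from
    LinearMap.congr_fun h t
  refine tensor_ext fun i j h x y => ?_
  rw [LinearMap.comp_apply, tensorEval_tmul, ← tmul_mul N 0 i j i n n (zero_add i) h h,
    unit_mul, LinearMap.id_apply]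

theorem tensorEval_tmul_unit (N : B.TwistModule b) (n : ℤ) (y : deg N n) :
    tensorEval N n (tmul N 0 n n (zero_add n) B.unit y) = y := by
  rw [tensorEval_tmul]
  exact N.one_act (B.twist b).pt n y

theorem tensorEval_tensorMap {N N' : B.TwistModule b} (φ : N ⟶ N') (n : ℤ) (t : Tensor N n) :
    tensorEval N' n (tensorMap φ n t) = φ.app (B.twist b).pt n (tensorEval N n t) := by
  suffices h : (tensorEval N' n).comp (tensorMap φ n) =
      (φ.app (B.twist b).pt n).comp (tensorEval N n) from LinearMap.congr_fun h t
  refine tensor_ext fun i j h x y => ?_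
  rw [LinearMap.comp_apply, LinearMap.comp_apply, tensorMap_tmul, tensorEval_tmul,
    tensorEval_tmul, app_smul]

end TwistModule

/-- The action maps `ₐB_b ⊗ N → N` are isomorphisms. -/
def induceIsoExtend (b : B.MaurerCartan) : B.induce b ≅ extend b :=
  NatIso.ofComponents (fun N => isoOfInverse
    { app := fun _ n => tensorEval N n
      app_d := fun a n t => tensorEval_tensorD N a n t
      app_act := fun _ _ i j n h f t => tensorEval_tensorAct N i j n h f t }
    (fun _ n => tmul N 0 n n (zero_add n) B.unit)
    (fun _ n t => tmul_unit_tensorEval N n t) (fun _ n y => tensorEval_tmul_unit N n y))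
    (fun φ => Hom.ext (funext fun _ => funext fun n => LinearMap.ext fun t =>
      tensorEval_tensorMap φ n t))

/-! ### Extension to `MC(B)` preserves coacyclicity. -/

/-- The exact triple of extensions to `MC(B)`. -/
def extendTriple (T : ExactTriple (B.twist b).toDGCategory) : ExactTriple B.MC where
  K := (extend b).obj T.K
  L := (extend b).obj T.L
  M := (extend b).obj T.M
  ι := (extend b).map T.ι
  π := (extend b).map T.π
  injective _ i := T.injective (B.twist b).pt i
  exact _ i := T.exact (B.twist b).pt i
  surjective _ i := T.surjective (B.twist b).pt i

theorem lmap_twistedDiff {S : Type u} (N : S → B.TwistModule b) (a : B.MaurerCartan) (i : ℤ)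
    (x : ⨁ s, deg (N s) i) :
    (DirectSum.lmap fun s => twistedDiff (N s) a i) x =
      (DirectSum.lmap fun s => diff (N s) i) x +
        (DirectSum.lmap fun s => smul (N s) 1 i (i + 1) (add_comm 1 i) (diffMC a b)) x := by
  ext s
  simp [DirectSum.lmap_apply, twistedDiff_apply]

/-- A homotopy has degree `-1` and so anticommutes with the odd element `a - b`; the two corrections
cancel and the same `s` works at every object. -/
theorem homotopy_twistedDiff {N N' : B.TwistModule b} {φ ψ : N ⟶ N'} (h : DGModule.Homotopy φ ψ)
    (a : B.MaurerCartan) (i : ℤ) (x : deg N (i + 1)) :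
    φ.app (B.twist b).pt (i + 1) x - ψ.app (B.twist b).pt (i + 1) x =
      twistedDiff N' a i (h.s (B.twist b).pt i x) +
        h.s (B.twist b).pt (i + 1) (twistedDiff N a (i + 1) x) := by
  have h1 : koszulSign 1 = -1 := by simp [koszulSign]
  have hs : h.s (B.twist b).pt (i + 1)
      (smul N 1 (i + 1) (i + 1 + 1) (by omega) (diffMC a b) x) =
      koszulSign 1 • smul N' 1 i (i + 1) (by omega) (diffMC a b) (h.s (B.twist b).pt i x) :=
    h.s_act (B.twist b).pt (B.twist b).pt 1 i (i + 1) (by omega) (diffMC (B := B) a b) x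
  refine (h.eq (B.twist b).pt i x).trans ?_
  change diff N' i (h.s (B.twist b).pt i x) + h.s (B.twist b).pt (i + 1) (diff N (i + 1) x) = _
  rw [twistedDiff_apply, twistedDiff_apply, map_add, hs, h1, neg_smul, one_smul]
  abel

/-- Compares shifting after twisting with twisting after shifting. The sign is left as `koszulSign
1` because that is the factor with which `a - b` acts on a shifted module. -/
theorem neg_twistedDiff (N : B.TwistModule b) (a : B.MaurerCartan) (i : ℤ) (x : deg N i) :
    -twistedDiff N a i x = -diff N i x +
      koszulSign 1 • smul N 1 i (i + 1) (add_comm 1 i) (diffMC a b) x := by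
  have h1 : koszulSign 1 = -1 := by simp [koszulSign]
  rw [twistedDiff_apply, h1, neg_smul, one_smul]
  abel

/-- Extension to `MC(B)` commutes with cones. -/
def coneExtend {N N' : B.TwistModule b} (φ : N ⟶ N') :
    cone ((extend b).map φ) ≅ (extend b).obj (cone φ) :=
  isoOfInverse
    { app := fun _ i => (LinearMap.id : deg (cone φ) i →ₗ[k] deg (cone φ) i)
      app_d := fun a i x => Prod.ext (neg_twistedDiff N a (i + 1) x.1)
        (add_assoc (φ.app (B.twist b).pt (i + 1) x.1) (diff N' i x.2) _).symm
      app_act := fun _ _ _ _ _ _ _ _ => rfl }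
    (fun _ i => (LinearMap.id : deg (cone φ) i →ₗ[k] deg (cone φ) i))
    (fun _ _ _ => rfl) (fun _ _ _ => rfl)

/-- Extension to `MC(B)` commutes with totalizations. -/
def totExtend (T : ExactTriple (B.twist b).toDGCategory) :
    (extendTriple T).tot ≅ (extend b).obj T.tot :=
  isoOfInverse
    { app := fun _ i => (LinearMap.id : deg T.tot i →ₗ[k] deg T.tot i)
      app_d := fun a i x => by
        -- A totalization is a cone on a cone: `coneExtend` handles the outer one here, and the
        -- inner one then enters through the first component, in degree `i + 1` and negated by the
        -- shift.
        refine Eq.trans ?_ ((coneExtend T.coneDesc).hom.app_d a i x)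
        refine Prod.ext (congrArg Neg.neg ((coneExtend T.ι).hom.app_d a (i + 1) x.1)) rfl
      app_act := fun _ _ _ _ _ _ _ _ => rfl }
    (fun _ i => (LinearMap.id : deg T.tot i →ₗ[k] deg T.tot i))
    (fun _ _ _ => rfl) (fun _ _ _ => rfl)

/-- Extension to `MC(B)` commutes with shifts. -/
def shiftExtend (N : B.TwistModule b) : ((extend b).obj N).shift ≅ (extend b).obj N.shift :=
  isoOfInverse
    { app := fun _ i => (LinearMap.id : deg N (i + 1) →ₗ[k] deg N (i + 1))
      app_d := fun a i x => neg_twistedDiff N a (i + 1) x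
      app_act := fun _ _ _ _ _ _ _ _ => rfl }
    (fun _ i => (LinearMap.id : deg N (i + 1) →ₗ[k] deg N (i + 1)))
    (fun _ _ _ => rfl) (fun _ _ _ => rfl)

/-- Extension to `MC(B)` commutes with direct sums. -/
def directSumExtend {S : Type u} (N : S → B.TwistModule b) :
    directSum (fun s => (extend b).obj (N s)) ≅ (extend b).obj (directSum N) :=
  isoOfInverse
    { app := fun _ i => (LinearMap.id : deg (directSum N) i →ₗ[k] deg (directSum N) i)
      app_d := fun a i x => lmap_twistedDiff N a i x
      app_act := fun _ _ _ _ _ _ _ _ => rfl }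
    (fun _ i => (LinearMap.id : deg (directSum N) i →ₗ[k] deg (directSum N) i))
    (fun _ _ _ => rfl) (fun _ _ _ => rfl)

theorem coacyclicFunctor_extend (b : B.MaurerCartan) : CoacyclicFunctor (extend b) where
  homotopic φ ψ := by
    rintro ⟨h⟩
    exact ⟨{ s := fun _ i => h.s (B.twist b).pt i
             s_act := fun _ _ => h.s_act (B.twist b).pt (B.twist b).pt
             eq := fun a i x => homotopy_twistedDiff h a i x }⟩
  tot T := .ofIso (totExtend T) (.tot _)
  directSum N := ⟨directSumExtend N⟩
  cone φ := ⟨coneExtend φ⟩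
  shift N := ⟨shiftExtend N⟩

end DGAlgebra

theorem mainTheorem5 {k : Type w} [Field k] (B : DGAlgebra.{w, u} k) (b : B.MaurerCartan) :
    ∃ E : DGModule.Dco B.MC ≌ DGModule.Dco (B.twist b).toDGCategory,
      Nonempty (DGModule.toDco B.MC ⋙ E.functor ≅
        B.restrict b ⋙ DGModule.toDco (B.twist b).toDGCategory) ∧
      Nonempty (DGModule.toDco (B.twist b).toDGCategory ⋙ E.inverse ≅
        B.induce b ⋙ DGModule.toDco B.MC) :=
  ⟨(DGAlgebra.coacyclicFunctor_restrict b).equivalence (DGAlgebra.coacyclicFunctor_extend b)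
      (DGAlgebra.restrictExtend b) (DGAlgebra.extendRestrict b),
    ⟨(DGAlgebra.coacyclicFunctor_restrict b).toDcoIso⟩,
    -- The inverse is built from `extend`, so the tensor product description is obtained by
    -- transport along `induceIsoExtend`.
    ⟨(DGAlgebra.coacyclicFunctor_extend b).toDcoIso ≪≫
      Functor.isoWhiskerRight (DGAlgebra.induceIsoExtend b).symm (DGModule.toDco B.MC)⟩⟩
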